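/- Consider a periodic chain of $N\ge 2$ sites with local dimension $d$, Hilbert space $\mathcal H=(\mathbb C^d)^{\otimes N}$, and links $(i,i+1)$ with $i\in\mathbb Z/N$. Let $\mathcal O$ be the span of all operators that act on a single link (quasi-local operators). For a unit vector $\psi\in\mathcal H$ (the target) let the kernelizer be the real vector space $$K_\psi=\{A\in\mathcal O: A=A^\dagger,\ A\psi=0\}\oplus\mathbb R\,\mathbf 1 .$$ Let $\rho_\psi^{(i,i+1)}$ be the reduced state of $|\psi\rangle\langle\psi|$ on the link $(i,i+1)$, let $\mathcal V_{\rm cold}^{(i,i+1)}=(\ker\rho_\psi^{(i,i+1)})^\perp$ and $\mathcal V_{\rm hot}^{(i,i+1)}=(\mathcal V_{\rm cold}^{(i,i+1)})^\perp$ be the cold and hot subspaces of the link, and let $\mathrm{Cold}_i$, $\mathrm{Hot}_i\subseteq\mathcal H$ be their tensor products with the Hilbert spaces of all other sites. Say that $\psi$ can be obtained by cooling a set $S$ of links (dilute cooling of a single link when $S=\{i\}$) if there are a Hermitian $H\in\mathcal O$, a rate $\gamma>0$ and, for each $i\in S$, finitely many operators $L_{i,j}$ on the link $(i,i+1)$ with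 $$L_{i,j}^2=0,\qquad \bigcap_j\ker L_{i,j}=\mathcal V_{\rm cold}^{(i,i+1)},\qquad \sum_j\operatorname{im}L_{i,j}\subseteq\mathcal V_{\rm cold}^{(i,i+1)},$$ such that $|\psi\rangle\langle\psi|$ is the unique density operator annihilated by $$\mathcal L(\rho)=-i[H,\rho]+\gamma\sum_{i\in S}\sum_j\Big(L_{i,j}\rho L_{i,j}^\dagger-\tfrac12\{L_{i,j}^\dagger L_{i,j},\rho\}\Big).$$ (1) Necessary condition. If $\psi$ can be obtained by cooling the links in $S$, then there is no $\phi\in\mathcal H$ that is not a multiple of $\psi$, lies in none of the subspaces $\mathrm{Hot}_i$ with $i\in S$, and is an eigenvector of every $A\in K_\psi$. (2) Let $d=2$ and $N\ge5$. For the GHZ state $\psi=\frac1{\sqrt2}(|0\rangle^{\otimes N}+|1\rangle^{\otimes N})$ with partner $\phi=\frac1{\sqrt2}(|0\rangle^{\otimes N}-|1\rangle^{\otimes N})$, and for the W state $\psi=\frac1{\sqrt N}(|10\cdots0\rangle+\dots+|0\cdots01\rangle)$ with partner $\phi=|0\cdots0\rangle$: the partner $\phi$ is an eigenvector of every $A\in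 K_\psi$, and for every $i$ one has $\phi\in\mathrm{Cold}_i$ and $\phi\notin\operatorname{span}\{\psi\}+\mathrm{Hot}_i$, so that the condition in (1) fails whichever links are cooled. For the GHZ state, moreover, $\phi$ and $\psi$ have the same reduced state on every link. Consequently neither the GHZ state nor the W state can be obtained by cooling any set of links; in particular neither can be obtained by dilute cooling. -/

import Mathlib

namespace DiluteCooling

open Matrix
open scoped ComplexOrder

noncomputable section

/-- Configurations of a periodic chain of `N` sites with `d` levels per site. They label the
product basis of the many-body Hilbert space. -/
abbrev Config (N d : ℕ) : Type := ZMod N → Fin d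

/-- The many-body Hilbert space `(ℂ^d)^{⊗ N}`, written in the product basis. -/
abbrev ManyBody (N d : ℕ) : Type := EuclideanSpace ℂ (Config N d)

/-- The Hilbert space `ℂ^d ⊗ ℂ^d` of one link. -/
abbrev LinkSpace (d : ℕ) : Type := EuclideanSpace ℂ (Fin d × Fin d)

/-- Operators on the many-body Hilbert space. -/
abbrev Op (N d : ℕ) : Type := Matrix (Config N d) (Config N d) ℂ

/-- Operators on the Hilbert space of one link. -/
abbrev LinkOp (d : ℕ) : Type := Matrix (Fin d × Fin d) (Fin d × Fin d) ℂ

/-- The part of a configuration on the link `(i, i+1)` (site indices are taken modulo `N`). -/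
def linkPart {N d : ℕ} (i : ZMod N) (x : Config N d) : Fin d × Fin d := (x i, x (i + 1))

/-- Two configurations agree on all sites outside the link `(i, i+1)`. -/
abbrev AgreeOff {N d : ℕ} (i : ZMod N) (x y : Config N d) : Prop :=
  ∀ k : ZMod N, k ≠ i → k ≠ i + 1 → x k = y k

/-- The operator `B ⊗ 1` on the chain, where `B` acts on the link `(i, i+1)` and the identity acts
on all other sites. -/
def onLink {N d : ℕ} [NeZero N] (i : ZMod N) : LinkOp d →ₗ[ℂ] Op N d where
  toFun B := Matrix.of fun x y => if AgreeOff i x y then B (linkPart i x) (linkPart i y) else 0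
  map_add' B C := by
    ext x y
    simp only [Matrix.of_apply, Matrix.add_apply]
    split_ifs <;> simp
  map_smul' c B := by
    ext x y
    simp only [Matrix.of_apply, Matrix.smul_apply, RingHom.id_apply]
    split_ifs <;> simp

/-- The space of quasi-local operators, the complex span of all operators that act on a single
link of nearest neighbours. (The products of generalized Pauli operators on the two sites of a link
form a basis of the operators on that link.) -/
def quasiLocal (N d : ℕ) [NeZero N] : Submodule ℂ (Op N d) :=
  Submodule.span ℂ (⋃ i : ZMod N, Set.range (onLink (d := d) i))

/-- The quasi-local Hermitian operators that annihilate the state `ψ`, a real vector space. -/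
def annihilators {N d : ℕ} [NeZero N] (ψ : ManyBody N d) : Submodule ℝ (Op N d) where
  carrier := {A | A ∈ quasiLocal N d ∧ A.IsHermitian ∧ Matrix.toEuclideanLin A ψ = 0}
  zero_mem' := ⟨Submodule.zero_mem _, Matrix.isHermitian_zero, by simp⟩
  add_mem' := by
    rintro A B ⟨hA, hA', hA''⟩ ⟨hB, hB', hB''⟩
    exact ⟨Submodule.add_mem _ hA hB, hA'.add hB', by simp [hA'', hB'']⟩
  smul_mem' := by
    rintro c A ⟨hA, hA', hA''⟩
    have hc : (c • A : Op N d) = (c : ℂ) • A := by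
      ext x y
      simp
    refine ⟨?_, ?_, ?_⟩
    · rw [hc]
      exact Submodule.smul_mem _ _ hA
    · rw [Matrix.IsHermitian, Matrix.conjTranspose_smul, hA'.eq, star_trivial]
    · rw [hc, map_smul, LinearMap.smul_apply, hA'', smul_zero]

/-- The kernelizer of `ψ`: the real vector space of the quasi-local Hermitian operators that
annihilate `ψ`, extended by the real multiples of the identity. -/
def kernelizer {N d : ℕ} [NeZero N] (ψ : ManyBody N d) : Submodule ℝ (Op N d) :=
  annihilators ψ ⊔ Submodule.span ℝ {(1 : Op N d)}

/-- The pure density operator `|ψ⟩⟨ψ|`. -/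
def pureState {N d : ℕ} (ψ : ManyBody N d) : Op N d :=
  Matrix.of fun x y => ψ x * star (ψ y)

/-- The reduced operator on the link `(i, i+1)`: partial trace over all other sites. -/
def reduced {N d : ℕ} [NeZero N] (i : ZMod N) (ρ : Op N d) : LinkOp d :=
  Matrix.of fun p q => ∑ x : Config N d, ∑ y : Config N d,
    if linkPart i x = p ∧ linkPart i y = q ∧ AgreeOff i x y then ρ x y else 0

/-- The local cold subspace of the link `(i, i+1)` for the target `ψ`: the support
`(ker ρ)^⊥` of the reduced target state `ρ`. -/
def coldLocal {N d : ℕ} [NeZero N] (ψ : ManyBody N d) (i : ZMod N) :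
    Submodule ℂ (LinkSpace d) :=
  (LinearMap.ker (Matrix.toEuclideanLin (reduced i (pureState ψ))))ᗮ

/-- The local hot subspace of the link `(i, i+1)`: the orthogonal complement of the cold one. -/
def hotLocal {N d : ℕ} [NeZero N] (ψ : ManyBody N d) (i : ZMod N) :
    Submodule ℂ (LinkSpace d) :=
  (coldLocal ψ i)ᗮ

/-- The configuration `x` with its values on the link `(i, i+1)` replaced by `p`. -/
def setLink {N d : ℕ} (i : ZMod N) (x : Config N d) (p : Fin d × Fin d) : Config N d :=
  Function.update (Function.update x i p.1) (i + 1) p.2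

/-- The vector of the link `(i, i+1)` obtained from a many-body vector by contracting all other
sites with the basis vectors given by `x`. -/
def slice {N d : ℕ} (i : ZMod N) (x : Config N d) : ManyBody N d →ₗ[ℂ] LinkSpace d where
  toFun φ := WithLp.toLp 2 fun p => φ (setLink i x p)
  map_add' φ χ := by
    ext p
    simp
  map_smul' c φ := by
    ext p
    simp

/-- The subspace `V ⊗ ⨂_{j ≠ i, i+1} ℂ^d` of the many-body space, for a subspace `V` of the link
`(i, i+1)`: the vectors whose contractions with all basis states of the other sites are in `V`. -/
def tensorRest {N d : ℕ} (i : ZMod N) (V : Submodule ℂ (LinkSpace d)) :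
    Submodule ℂ (ManyBody N d) :=
  ⨅ x : Config N d, V.comap (slice i x)

/-- The hot subspace of the cooled link `(i, i+1)` in the many-body space. -/
def hot {N d : ℕ} [NeZero N] (ψ : ManyBody N d) (i : ZMod N) : Submodule ℂ (ManyBody N d) :=
  tensorRest i (hotLocal ψ i)

/-- The cold subspace of the link `(i, i+1)` in the many-body space. -/
def cold {N d : ℕ} [NeZero N] (ψ : ManyBody N d) (i : ZMod N) : Submodule ℂ (ManyBody N d) :=
  tensorRest i (coldLocal ψ i)

/-- A family of jump operators on the link `(i, i+1)` that do nothing but cool towards `ψ`: they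
are nilpotent of order two, their joint kernel is the cold subspace, and their images lie in the
cold subspace. -/
structure IsCoolingFamily {N d m : ℕ} [NeZero N] (ψ : ManyBody N d) (i : ZMod N)
    (L : Fin m → LinkOp d) : Prop where
  sq_eq_zero : ∀ j, L j * L j = 0
  iInf_ker : ⨅ j, LinearMap.ker (Matrix.toEuclideanLin (L j)) = coldLocal ψ i
  iSup_range : ⨆ j, LinearMap.range (Matrix.toEuclideanLin (L j)) ≤ coldLocal ψ i

/-- The dissipator `L ρ L† - ½ {L† L, ρ}` of one jump operator. -/
def dissipator {N d : ℕ} [NeZero N] (L ρ : Op N d) : Op N d :=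
  L * ρ * Lᴴ - (1 / 2 : ℂ) • (Lᴴ * L * ρ + ρ * (Lᴴ * L))

/-- The GKSL generator with Hamiltonian `H`, dissipation rate `γ` and the jump operators
`L i j` acting on the links `(i, i+1)` for `i ∈ S`. -/
def lindbladian {N d : ℕ} [NeZero N] (H : Op N d) (γ : ℝ) (S : Finset (ZMod N))
    {m : ZMod N → ℕ} (L : (i : ZMod N) → Fin (m i) → LinkOp d) (ρ : Op N d) : Op N d :=
  -Complex.I • (H * ρ - ρ * H) + (γ : ℂ) • ∑ i ∈ S, ∑ j, dissipator (onLink i (L i j)) ρ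

/-- Density operators. -/
def IsDensity {N d : ℕ} [NeZero N] (ρ : Op N d) : Prop := ρ.PosSemidef ∧ ρ.trace = 1

/-- `ρ₀` is the unique steady state of the generator `G`. -/
def IsUniqueSteadyState {N d : ℕ} [NeZero N] (G : Op N d → Op N d) (ρ₀ : Op N d) : Prop :=
  (IsDensity ρ₀ ∧ G ρ₀ = 0) ∧ ∀ ρ : Op N d, IsDensity ρ → G ρ = 0 → ρ = ρ₀

/-- The target `ψ` can be obtained by blind cooling of the links `(i, i+1)`, `i ∈ S` (a single
cooled link when `S` is a singleton), with full quasi-local coherent control: for some quasi-local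
Hamiltonian, some dissipation rate and some cooling jump operators on the cooled links, the target
is the unique steady state. -/
def Coolable {N d : ℕ} [NeZero N] (ψ : ManyBody N d) (S : Finset (ZMod N)) : Prop :=
  ∃ H ∈ quasiLocal N d, H.IsHermitian ∧ ∃ γ : ℝ, 0 < γ ∧
    ∃ (m : ZMod N → ℕ) (L : (i : ZMod N) → Fin (m i) → LinkOp d),
      (∀ i ∈ S, IsCoolingFamily ψ i (L i)) ∧
        IsUniqueSteadyState (lindbladian H γ S L) (pureState ψ)

/-- `φ` is an eigenstate (in particular non-zero) of every operator of the kernelizer of `ψ`. -/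
def IsCommonEigenstate {N d : ℕ} [NeZero N] (ψ φ : ManyBody N d) : Prop :=
  ∀ A ∈ kernelizer ψ, ∃ c : ℂ, Module.End.HasEigenvector (Matrix.toEuclideanLin A) c φ

/-- The GHZ state. -/
def ghz (N : ℕ) [NeZero N] : ManyBody N 2 :=
  ((1 / √2 : ℝ) : ℂ) • (EuclideanSpace.single (fun _ => 0) 1 + EuclideanSpace.single (fun _ => 1) 1)

/-- The antisymmetric GHZ state. -/
def ghzMinus (N : ℕ) [NeZero N] : ManyBody N 2 :=
  ((1 / √2 : ℝ) : ℂ) • (EuclideanSpace.single (fun _ => 0) 1 - EuclideanSpace.single (fun _ => 1) 1)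

/-- The W state: the equal superposition of all configurations with exactly one `1`. -/
def wState (N : ℕ) [NeZero N] : ManyBody N 2 :=
  ((1 / √(N : ℝ) : ℝ) : ℂ) • ∑ k : ZMod N, EuclideanSpace.single (Pi.single k 1) 1

/-- The product state in which all sites are in the level `0`. -/
def wZero (N : ℕ) [NeZero N] : ManyBody N 2 :=
  EuclideanSpace.single (fun _ => 0) 1

end

end DiluteCooling

open DiluteCooling

namespace DiluteCooling

open Matrix
open scoped ComplexOrder

/-! ### Links and slices -/

/-! Necessary condition: `ψ` lies in its own cold subspaces (`self_mem_cold`), so all jump operators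
kill it and stationarity reduces to `[H, |ψ⟩⟨ψ|] = 0`. Hence `Hψ = Eψ` with `E` real, and `H = (H -
E) + E` is in the kernelizer. So are the projectors onto the hot subspaces, which annihilate `ψ`. A
common eigenvector `φ` outside a hot subspace has eigenvalue 0 for that projector, so it is cold
there (`mem_cold_of_isCommonEigenstate`). Being also an eigenvector of `H`, it yields after
normalisation a second steady state, against uniqueness.

The examples rest on locality: a quasi-local `B` has nonzero matrix elements only between
configurations that differ within one link (`exists_agreeOff_of_ne_zero`). For GHZ, `Bψ = 0` makes
the two columns of `B` at the constant configurations opposite. A row where both are nonzero would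
be within one link of all zeros and of all ones, which needs at most four sites; so both columns
vanish.

For W, the task is to show that `B` maps the vacuum to a multiple of itself. A spectator excitation
placed far away does not change a matrix element (`quasiLocal_apply_update`), which turns amplitudes
out of the vacuum into amplitudes out of a one-excitation state, where `Bψ = 0` applies. This kills
the creation of pairs (`apply_pair_zero`), and makes single-excitation amplitudes opposite on
non-neighbouring sites; an odd cycle of such sites kills these too (`apply_single_zero`). -/

theorem toEuclideanLin_ofLp {m n : Type*} [Fintype n] [DecidableEq n] (A : Matrix m n ℂ)
    (v : EuclideanSpace ℂ n) : (toEuclideanLin A v).ofLp = A *ᵥ v.ofLp := rfl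

section Links

variable {N d : ℕ}

theorem natCast_ne_zero_of_lt {N n : ℕ} (hn : 0 < n) (h : n < N) : (n : ZMod N) ≠ 0 := by
  rw [Ne, ZMod.natCast_eq_zero_iff]
  exact fun hd => absurd (Nat.le_of_dvd hn hd) (by omega)

theorem add_one_ne_self (hN : 2 ≤ N) (i : ZMod N) : i + 1 ≠ i := by
  have h := natCast_ne_zero_of_lt (n := 1) one_pos (show 1 < N by omega)
  intro h'
  apply h
  push_cast
  linear_combination h'

theorem AgreeOff.symm {i : ZMod N} {x y : Config N d} (h : AgreeOff i x y) : AgreeOff i y x :=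
  fun k hk hk' => (h k hk hk').symm

theorem setLink_apply_of_ne (i : ZMod N) (x : Config N d) (p : Fin d × Fin d) {k : ZMod N}
    (h : k ≠ i) (h' : k ≠ i + 1) : setLink i x p k = x k := by
  simp [setLink, h, h']

theorem linkPart_setLink (hN : 2 ≤ N) (i : ZMod N) (x : Config N d) (p : Fin d × Fin d) :
    linkPart i (setLink i x p) = p := by
  simp [setLink, linkPart, (add_one_ne_self hN i).symm]

theorem agreeOff_setLink (i : ZMod N) (x : Config N d) (p : Fin d × Fin d) :
    AgreeOff i x (setLink i x p) :=
  fun _ hk hk' => (setLink_apply_of_ne i x p hk hk').symm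

theorem setLink_eq_of_agreeOff (hN : 2 ≤ N) {i : ZMod N} {x y : Config N d}
    (h : AgreeOff i x y) : setLink i x (linkPart i y) = y := by
  funext k
  by_cases hk : k = i
  · subst hk
    exact congrArg Prod.fst (linkPart_setLink hN k x (linkPart k y))
  by_cases hk' : k = i + 1
  · subst hk'
    exact congrArg Prod.snd (linkPart_setLink hN i x (linkPart i y))
  rw [setLink_apply_of_ne i x _ hk hk', h k hk hk']

theorem setLink_linkPart (hN : 2 ≤ N) (i : ZMod N) (x : Config N d) :
    setLink i x (linkPart i x) = x :=
  setLink_eq_of_agreeOff hN fun _ _ _ => rfl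

theorem setLink_setLink (hN : 2 ≤ N) (i : ZMod N) (x : Config N d) (p q : Fin d × Fin d) :
    setLink i (setLink i x p) q = setLink i x q := by
  have h : AgreeOff i (setLink i x p) (setLink i x q) := fun k hk hk' => by
    rw [setLink_apply_of_ne i x p hk hk', setLink_apply_of_ne i x q hk hk']
  simpa [linkPart_setLink hN] using setLink_eq_of_agreeOff hN h

@[simp]
theorem slice_apply (i : ZMod N) (x : Config N d) (φ : ManyBody N d) (p : Fin d × Fin d) :
    slice i x φ p = φ (setLink i x p) := rfl

theorem eq_of_slice_eq (hN : 2 ≤ N) (i : ZMod N) {φ χ : ManyBody N d}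
    (h : ∀ x, slice i x φ = slice i x χ) : φ = χ := by
  ext x
  have := congrArg (fun v : LinkSpace d => v (linkPart i x)) (h x)
  simpa [setLink_linkPart hN] using this

theorem mem_tensorRest {i : ZMod N} {V : Submodule ℂ (LinkSpace d)} {φ : ManyBody N d} :
    φ ∈ tensorRest i V ↔ ∀ x, slice i x φ ∈ V := by
  simp [tensorRest]

variable [NeZero N]

theorem sum_agreeOff {M : Type*} [AddCommMonoid M] (hN : 2 ≤ N) (i : ZMod N) (x : Config N d)
    (f : Config N d → M) :
    ∑ y, (if AgreeOff i x y then f y else 0) = ∑ q, f (setLink i x q) := by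
  rw [← Finset.sum_filter]
  refine Finset.sum_nbij' (linkPart i) (setLink i x) (by simp) ?_ ?_ ?_ ?_
  · intro q _
    simpa using agreeOff_setLink i x q
  · intro y hy
    exact setLink_eq_of_agreeOff hN (Finset.mem_filter.1 hy).2
  · intro q _
    exact linkPart_setLink hN i x q
  · intro y hy
    rw [setLink_eq_of_agreeOff hN (Finset.mem_filter.1 hy).2]

theorem sum_sum_setLink {M : Type*} [AddCommMonoid M] (hN : 2 ≤ N) (i : ZMod N)
    (f : Config N d → M) :
    ∑ x, ∑ p, f (setLink i x p) = Fintype.card (Fin d × Fin d) • ∑ x, f x := by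
  -- The involution that swaps the link part of the configuration with the separate link
  -- configuration.
  let e : Config N d × (Fin d × Fin d) ≃ Config N d × (Fin d × Fin d) :=
    { toFun := fun z => (setLink i z.1 z.2, linkPart i z.1)
      invFun := fun z => (setLink i z.1 z.2, linkPart i z.1)
      left_inv := fun z => by simp [setLink_setLink hN, linkPart_setLink hN, setLink_linkPart hN]
      right_inv := fun z => by
        simp [setLink_setLink hN, linkPart_setLink hN, setLink_linkPart hN] }
  have h := Equiv.sum_comp e fun z => f z.1
  rw [Fintype.sum_prod_type, Fintype.sum_prod_type] at h
  refine h.trans ?_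
  simp only [Finset.sum_const, Finset.card_univ, Finset.smul_sum]

theorem onLink_apply (i : ZMod N) (B : LinkOp d) (x y : Config N d) :
    onLink i B x y = if AgreeOff i x y then B (linkPart i x) (linkPart i y) else 0 := rfl

theorem slice_onLink (hN : 2 ≤ N) (i : ZMod N) (x : Config N d) (B : LinkOp d)
    (φ : ManyBody N d) :
    slice i x (toEuclideanLin (onLink i B) φ) = toEuclideanLin B (slice i x φ) := by
  ext p
  rw [slice_apply, toEuclideanLin_ofLp, toEuclideanLin_ofLp]
  simp only [mulVec, dotProduct, onLink_apply, ite_mul, zero_mul]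
  rw [sum_agreeOff hN]
  simp [linkPart_setLink hN, setLink_setLink hN]

theorem onLink_one (hN : 2 ≤ N) (i : ZMod N) : onLink i (1 : LinkOp d) = (1 : Op N d) := by
  ext x y
  rw [onLink_apply, one_apply, one_apply]
  by_cases h : x = y
  · subst h
    simp
  · rw [if_neg h]
    refine ite_eq_right_iff.2 fun h' => if_neg fun hl => h ?_
    rw [← setLink_eq_of_agreeOff hN h', ← hl, setLink_linkPart hN]

theorem onLink_mem_quasiLocal (i : ZMod N) (B : LinkOp d) : onLink i B ∈ quasiLocal N d :=
  Submodule.subset_span (Set.mem_iUnion.2 ⟨i, B, rfl⟩)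

theorem one_mem_quasiLocal (hN : 2 ≤ N) : (1 : Op N d) ∈ quasiLocal N d :=
  onLink_one hN (0 : ZMod N) ▸ onLink_mem_quasiLocal _ _

theorem isHermitian_onLink (i : ZMod N) {B : LinkOp d} (hB : B.IsHermitian) :
    (onLink i B : Op N d).IsHermitian := by
  ext x y
  rw [conjTranspose_apply, onLink_apply, onLink_apply, apply_ite star, star_zero]
  have h : AgreeOff i y x ↔ AgreeOff i x y := ⟨AgreeOff.symm, AgreeOff.symm⟩
  simp only [h, hB.apply]

end Links

/-! ### Cold and hot subspaces -/

section Cold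

variable {N d : ℕ} [NeZero N]

theorem reduced_pureState_apply (hN : 2 ≤ N) (i : ZMod N) (ψ : ManyBody N d)
    (p q : Fin d × Fin d) :
    reduced i (pureState ψ) p q =
      ∑ x, if linkPart i x = p then ψ x * star (ψ (setLink i x q)) else 0 := by
  rw [reduced, of_apply]
  refine Finset.sum_congr rfl fun x _ => ?_
  have h : ∀ y, (if linkPart i x = p ∧ linkPart i y = q ∧ AgreeOff i x y
      then pureState ψ x y else 0) = if AgreeOff i x y then
        (if linkPart i x = p ∧ linkPart i y = q then pureState ψ x y else 0) else 0 := by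
    intro y
    by_cases h1 : linkPart i x = p <;> by_cases h2 : linkPart i y = q <;>
      by_cases h3 : AgreeOff i x y <;> simp only [h1, h2, h3, if_true, if_false, true_and,
        and_true, and_self, false_and, and_false, ite_self]
  simp only [h]
  rw [sum_agreeOff hN]
  by_cases h1 : linkPart i x = p
  · simp [h1, linkPart_setLink hN, pureState]
  · simp [h1]

/-- Every vector lies in its own cold subspaces. -/
theorem self_mem_cold (hN : 2 ≤ N) (ψ : ManyBody N d) (i : ZMod N) : ψ ∈ cold ψ i := by
  refine mem_tensorRest.2 fun x => (Submodule.mem_orthogonal' _ _).2 fun v hv => ?_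
  let f : Config N d → ℂ := fun x => ∑ q, star (ψ (setLink i x q)) * v q
  have hf : ∀ x, inner ℂ (slice i x ψ) v = f x := fun x => by
    simp [PiLp.inner_apply, f, mul_comm]
  rw [hf]
  -- With `ρ` the reduced state, `∑ g = ⟨v, ρ v⟩ = 0`. As `f` ignores the values on the link,
  -- summing `g` over them gives `|f x|²`; a vanishing sum of such terms forces `f = 0`.
  let g : Config N d → ℂ := fun x => star (v (linkPart i x)) * (ψ x * f x)
  have hρ : ∀ p, ∑ x, (if linkPart i x = p then ψ x * f x else 0) = 0 := by
    intro p
    have h := congrArg (fun w : LinkSpace d => w p) (LinearMap.mem_ker.1 hv)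
    simp only [toEuclideanLin_ofLp, mulVec, dotProduct, reduced_pureState_apply hN,
      Finset.sum_mul] at h
    rw [Finset.sum_comm] at h
    refine Eq.trans (Finset.sum_congr rfl fun x _ => ?_) h
    by_cases h1 : linkPart i x = p
    · simp [h1, f, Finset.mul_sum, mul_assoc]
    · simp [h1]
  have hg : ∑ x, g x = 0 := by
    calc ∑ x, g x = ∑ x, ∑ p, (if linkPart i x = p then star (v p) * (ψ x * f x) else 0) := by
          simp [g]
      _ = ∑ p, star (v p) * ∑ x, (if linkPart i x = p then ψ x * f x else 0) := by
          rw [Finset.sum_comm]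
          simp only [Finset.mul_sum, mul_ite, mul_zero]
      _ = 0 := by simp [hρ]
  have hfg : ∀ x, ∑ p, g (setLink i x p) = star (f x) * f x := by
    intro x
    have hfx : ∀ p, f (setLink i x p) = f x := fun p => by simp only [f, setLink_setLink hN]
    have hsf : star (f x) = ∑ p, star (v p) * ψ (setLink i x p) := by
      simp [f, mul_comm]
    simp only [g, hfx, linkPart_setLink hN, hsf, Finset.sum_mul, mul_assoc]
  have hs := sum_sum_setLink hN i g
  rw [hg, smul_zero] at hs
  simp only [hfg] at hs
  have := (Finset.sum_eq_zero_iff_of_nonneg fun x _ => star_mul_self_nonneg (f x)).1 hs x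
    (Finset.mem_univ _)
  simpa using this

theorem disjoint_cold_hot (hN : 2 ≤ N) (ψ : ManyBody N d) (i : ZMod N) :
    Disjoint (cold ψ i) (hot ψ i) := by
  rw [Submodule.disjoint_def]
  intro φ hc hh
  refine eq_of_slice_eq hN i fun x => ?_
  rw [map_zero]
  exact (Submodule.disjoint_def.1 (Submodule.orthogonal_disjoint _)) _
    (mem_tensorRest.1 hc x) (mem_tensorRest.1 hh x)

/-- In a decomposition of `φ` the hot summand is a difference of cold vectors, so it is both hot and
cold, hence zero. -/
theorem notMem_span_sup_hot (hN : 2 ≤ N) {ψ φ : ManyBody N d} {i : ZMod N}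
    (hφ : φ ∈ cold ψ i) (h : φ ∉ Submodule.span ℂ {ψ}) :
    φ ∉ Submodule.span ℂ {ψ} ⊔ hot ψ i := by
  intro hmem
  obtain ⟨a, ha, b, hb, rfl⟩ := Submodule.mem_sup.1 hmem
  have hac : a ∈ cold ψ i :=
    (Submodule.span_singleton_le_iff_mem _ _).2 (self_mem_cold hN ψ i) ha
  have hbc : b ∈ cold ψ i := by simpa using Submodule.sub_mem _ hφ hac
  rw [Submodule.disjoint_def.1 (disjoint_cold_hot hN ψ i) b hbc hb, add_zero] at h
  exact h ha

theorem mem_cold_of_isCommonEigenstate (hN : 2 ≤ N) {ψ φ : ManyBody N d} {i : ZMod N}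
    (hφ : IsCommonEigenstate ψ φ) (h : φ ∉ hot ψ i) : φ ∈ cold ψ i := by
  -- The orthogonal projector onto the local hot subspace; its kernel is the cold subspace.
  let P : LinkOp d := toEuclideanLin.symm (hotLocal ψ i).starProjection.toLinearMap
  have hP : ∀ v, toEuclideanLin P v = (hotLocal ψ i).starProjection v := fun v => by simp [P]
  have hPh : P.IsHermitian := by
    rw [← isSymmetric_toEuclideanLin_iff]
    intro v w
    rw [hP, hP]
    exact Submodule.inner_starProjection_left_eq_right _ v w
  have hcold : ∀ v, v ∈ coldLocal ψ i ↔ toEuclideanLin P v = 0 := fun v => by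
    rw [hP, Submodule.starProjection_apply_eq_zero_iff, hotLocal,
      Submodule.orthogonal_orthogonal]
  have hPψ : toEuclideanLin (onLink i P) ψ = 0 := by
    refine eq_of_slice_eq hN i fun x => ?_
    rw [slice_onLink hN, map_zero]
    exact (hcold _).1 (mem_tensorRest.1 (self_mem_cold hN ψ i) x)
  obtain ⟨c, hc⟩ := hφ (onLink i P) (Submodule.mem_sup_left
    ⟨onLink_mem_quasiLocal _ _, isHermitian_onLink i hPh, hPψ⟩)
  have hs : ∀ x, toEuclideanLin P (slice i x φ) = c • slice i x φ := fun x => by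
    rw [← slice_onLink hN, hc.apply_eq_smul, map_smul]
  by_cases h0 : c = 0
  · exact mem_tensorRest.2 fun x => (hcold _).2 (by rw [hs, h0, zero_smul])
  -- For `c ≠ 0` every slice equals `c⁻¹ P` applied to itself, so it lies in the range of `P`.
  · refine absurd (mem_tensorRest.2 fun x => ?_) h
    rw [← inv_smul_smul₀ h0 (slice i x φ), ← hs, hP]
    exact Submodule.smul_mem _ _ (Submodule.starProjection_apply_mem _ _)

end Cold

/-! ### Dark states -/

section Dark

variable {N d : ℕ}

theorem pureState_eq_vecMulVec (φ : ManyBody N d) :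
    pureState φ = vecMulVec φ.ofLp (star φ.ofLp) := rfl

variable [NeZero N]

theorem mul_pureState (A : Op N d) (φ : ManyBody N d) :
    A * pureState φ = vecMulVec (toEuclideanLin A φ).ofLp (star φ.ofLp) := by
  rw [pureState_eq_vecMulVec, mul_vecMulVec, toEuclideanLin_ofLp]

theorem pureState_mul (A : Op N d) (φ : ManyBody N d) :
    pureState φ * A = vecMulVec φ.ofLp (star (toEuclideanLin Aᴴ φ).ofLp) := by
  rw [pureState_eq_vecMulVec, vecMulVec_mul, toEuclideanLin_ofLp, star_mulVec,
    conjTranspose_conjTranspose]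

theorem trace_pureState (φ : ManyBody N d) : (pureState φ).trace = (‖φ‖ ^ 2 : ℝ) := by
  rw [EuclideanSpace.norm_sq_eq, trace]
  push_cast
  refine Finset.sum_congr rfl fun x _ => ?_
  simp [pureState, Complex.mul_conj, Complex.normSq_eq_norm_sq]

theorem isDensity_pureState {φ : ManyBody N d} (h : ‖φ‖ = 1) : IsDensity (pureState φ) :=
  ⟨posSemidef_vecMulVec_self_star _, by simp [trace_pureState, h]⟩

theorem mem_span_of_pureState_eq {φ ψ : ManyBody N d} (hφ : ‖φ‖ = 1)
    (h : pureState φ = pureState ψ) : φ ∈ Submodule.span ℂ {ψ} := by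
  refine Submodule.mem_span_singleton.2 ⟨star ψ.ofLp ⬝ᵥ φ.ofLp, ?_⟩
  have e : ∀ χ : ManyBody N d,
      pureState χ *ᵥ φ.ofLp = (star χ.ofLp ⬝ᵥ φ.ofLp) • χ.ofLp := fun χ => by
    rw [pureState_eq_vecMulVec, vecMulVec_mulVec]
    ext x
    simp [mul_comm]
  have h2 : star φ.ofLp ⬝ᵥ φ.ofLp = 1 := by
    have := trace_pureState φ
    rw [pureState_eq_vecMulVec, trace_vecMulVec, hφ, dotProduct_comm] at this
    simpa using this
  have h3 := e φ
  rw [h, e ψ, h2, one_smul] at h3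
  ext x
  simpa using congrFun h3 x

theorem dissipator_pureState_eq_zero {A : Op N d} {φ : ManyBody N d}
    (h : toEuclideanLin A φ = 0) : dissipator A (pureState φ) = 0 := by
  have h1 : A * pureState φ = 0 := by rw [mul_pureState, h]; simp
  have h2 : pureState φ * Aᴴ = 0 := by
    rw [pureState_mul, conjTranspose_conjTranspose, h]; simp
  rw [dissipator, mul_assoc Aᴴ, h1, ← mul_assoc (pureState φ), h2]
  simp

theorem onLink_apply_eq_zero {ψ φ : ManyBody N d} (hN : 2 ≤ N) {i : ZMod N} {m : ℕ}
    {L : Fin m → LinkOp d} (hL : IsCoolingFamily ψ i L) (hφ : φ ∈ cold ψ i) (j : Fin m) :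
    toEuclideanLin (onLink i (L j)) φ = 0 := by
  refine eq_of_slice_eq hN i fun x => ?_
  rw [slice_onLink hN, map_zero]
  have h := mem_tensorRest.1 hφ x
  rw [← hL.iInf_ker] at h
  exact LinearMap.mem_ker.1 ((Submodule.mem_iInf _).1 h j)

theorem lindbladian_pureState {ψ φ : ManyBody N d} (hN : 2 ≤ N) (H : Op N d) (γ : ℝ)
    {S : Finset (ZMod N)} {m : ZMod N → ℕ} {L : (i : ZMod N) → Fin (m i) → LinkOp d}
    (hL : ∀ i ∈ S, IsCoolingFamily ψ i (L i)) (hφ : ∀ i ∈ S, φ ∈ cold ψ i) :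
    lindbladian H γ S L (pureState φ) = -Complex.I • (H * pureState φ - pureState φ * H) := by
  rw [lindbladian, Finset.sum_eq_zero fun i hi => Finset.sum_eq_zero fun j _ =>
    dissipator_pureState_eq_zero (onLink_apply_eq_zero hN (hL i hi) (hφ i hi) j)]
  simp

/-- Applying the commutation relation to `ψ` gives `Hψ = ⟨ψ, Hψ⟩ ψ`, and this expectation value is
real because `H` is Hermitian. -/
theorem exists_apply_eq_smul_of_commute {H : Op N d} (hH : H.IsHermitian) {ψ : ManyBody N d}
    (hψ : ‖ψ‖ = 1) (h : H * pureState ψ - pureState ψ * H = 0) :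
    ∃ E : ℝ, toEuclideanLin H ψ = (E : ℂ) • ψ := by
  have hsym : (toEuclideanLin H).IsSymmetric := isSymmetric_toEuclideanLin_iff.2 hH
  have e : ∀ χ : ManyBody N d,
      toEuclideanLin (pureState ψ) χ = inner ℂ ψ χ • ψ := fun χ => by
    ext x
    rw [toEuclideanLin_ofLp, pureState_eq_vecMulVec, vecMulVec_mulVec,
      EuclideanSpace.inner_eq_star_dotProduct, dotProduct_comm]
    simp [mul_comm]
  have h1 := congrArg (fun A : Op N d => toEuclideanLin A ψ) (sub_eq_zero.1 h)
  simp only [toLpLin_mul_same, LinearMap.comp_apply] at h1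
  rw [e, e, inner_self_eq_norm_sq_to_K, hψ] at h1
  refine ⟨(inner ℂ ψ (toEuclideanLin H ψ)).re, ?_⟩
  have hre : ((inner ℂ ψ (toEuclideanLin H ψ)).re : ℂ) = inner ℂ ψ (toEuclideanLin H ψ) := by
    rw [← Complex.conj_eq_iff_re, inner_conj_symm]
    exact hsym ψ ψ
  rw [hre, ← h1]
  simp

/-- The necessary condition for cooling. -/
theorem not_coolable_of_isCommonEigenstate (hN : 2 ≤ N) {ψ φ : ManyBody N d} (hψ : ‖ψ‖ = 1)
    {S : Finset (ZMod N)} (hφψ : φ ∉ Submodule.span ℂ {ψ}) (hhot : ∀ i ∈ S, φ ∉ hot ψ i)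
    (hφ : IsCommonEigenstate ψ φ) : ¬ Coolable ψ S := by
  rintro ⟨H, hHq, hH, γ, -, m, L, hL, ⟨-, hst⟩, huniq⟩
  rw [lindbladian_pureState hN H γ hL fun i _ => self_mem_cold hN ψ i, smul_eq_zero] at hst
  obtain ⟨E, hE⟩ := exists_apply_eq_smul_of_commute hH hψ (hst.resolve_left (by simp))
  have hone : (((E : ℂ) • (1 : Op N d))) = E • (1 : Op N d) := by
    ext x y
    simp
  have hHK : H ∈ kernelizer ψ := by
    refine Submodule.mem_sup.2 ⟨H - (E : ℂ) • 1, ⟨?_, ?_, ?_⟩, (E : ℂ) • 1, ?_, by simp⟩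
    · exact Submodule.sub_mem _ hHq (Submodule.smul_mem _ _ (one_mem_quasiLocal hN))
    · refine hH.sub ?_
      rw [IsHermitian, conjTranspose_smul, conjTranspose_one]
      simp
    · rw [map_sub, map_smul, toLpLin_one, LinearMap.sub_apply, hE]
      simp
    · rw [hone]
      exact Submodule.smul_mem _ _ (Submodule.mem_span_singleton_self _)
  obtain ⟨c, hc⟩ := hφ H hHK
  have hφ0 : ‖φ‖ ≠ 0 := norm_ne_zero_iff.2 hc.2
  obtain ⟨χ, hχφ⟩ : ∃ χ : ManyBody N d, χ = ((‖φ‖⁻¹ : ℝ) : ℂ) • φ := ⟨_, rfl⟩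
  have hχ : ‖χ‖ = 1 := by
    rw [hχφ, norm_smul, Complex.norm_real, norm_inv, norm_norm, inv_mul_cancel₀ hφ0]
  have hχc : ∀ i ∈ S, χ ∈ cold ψ i := fun i hi =>
    hχφ ▸ Submodule.smul_mem _ _ (mem_cold_of_isCommonEigenstate hN hφ (hhot i hi))
  have hHχ : toEuclideanLin H χ = c • χ := by
    rw [hχφ, map_smul, hc.apply_eq_smul, smul_comm]
  -- The commutator of `H` with the pure state of `χ` is `c - star c` times that state.
  have hreal : star c = c := by
    have hsym : (toEuclideanLin H).IsSymmetric := isSymmetric_toEuclideanLin_iff.2 hH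
    have := hsym χ χ
    rw [hHχ, inner_smul_left, inner_smul_right, inner_self_eq_norm_sq_to_K, hχ] at this
    simpa using this
  have hcomm : H * pureState χ - pureState χ * H = 0 := by
    rw [mul_pureState, pureState_mul, hH.eq, hHχ]
    ext x y
    have : (starRingEnd ℂ) c = c := hreal
    simp [vecMulVec_apply, this]
  have hss : lindbladian H γ S L (pureState χ) = 0 := by
    rw [lindbladian_pureState hN H γ hL hχc, hcomm, smul_zero]
  have hmem := mem_span_of_pureState_eq hχ (huniq _ (isDensity_pureState hχ) hss)
  apply hφψ
  have := Submodule.smul_mem _ ((‖φ‖ : ℝ) : ℂ) hmem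
  rwa [hχφ, smul_smul, ← Complex.ofReal_mul, mul_inv_cancel₀ hφ0, Complex.ofReal_one, one_smul]
    at this

end Dark

/-! ### Matrix elements of quasi-local operators -/

section Locality

variable {N d : ℕ}

theorem eq_or_eq_of_agreeOff {i k : ZMod N} {x y : Config N d} (h : AgreeOff i x y)
    (hk : x k ≠ y k) : k = i ∨ k = i + 1 := by
  by_contra! h'
  exact hk (h k h'.1 h'.2)

/-- Configurations that agree off a link cannot differ at two distinct sites that are not
neighbours. -/
theorem not_agreeOff_of_ne {i a c : ZMod N} {x y : Config N d} (ha : x a ≠ y a) (hc : x c ≠ y c)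
    (h : c ≠ a) (h1 : c ≠ a + 1) (h2 : a ≠ c + 1) : ¬ AgreeOff i x y := by
  intro hi
  rcases eq_or_eq_of_agreeOff hi ha with rfl | rfl <;>
    rcases eq_or_eq_of_agreeOff hi hc with rfl | rfl <;> simp_all

/-- Configurations that agree off a link cannot differ at three distinct sites. -/
theorem not_agreeOff_of_ne₃ {i a b c : ZMod N} {x y : Config N d} (ha : x a ≠ y a)
    (hb : x b ≠ y b) (hc : x c ≠ y c) (hab : a ≠ b) (hac : a ≠ c) (hbc : b ≠ c) :
    ¬ AgreeOff i x y := by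
  intro hi
  rcases eq_or_eq_of_agreeOff hi ha with rfl | rfl <;>
    rcases eq_or_eq_of_agreeOff hi hb with rfl | rfl <;>
      rcases eq_or_eq_of_agreeOff hi hc with rfl | rfl <;> simp_all

variable [NeZero N]

theorem exists_agreeOff_of_ne_zero {B : Op N d} (hB : B ∈ quasiLocal N d) {x y : Config N d}
    (h : B x y ≠ 0) : ∃ i, AgreeOff i x y := by
  contrapose! h
  induction hB using Submodule.span_induction with
  | mem A hA =>
    obtain ⟨i, C, rfl⟩ := Set.mem_iUnion.1 hA
    rw [onLink_apply, if_neg (not_forall.2 ?_)]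
    simpa using h i
  | zero => rfl
  | add A C _ _ hA hC => rw [Matrix.add_apply, hA, hC, add_zero]
  | smul c A _ hA => rw [Matrix.smul_apply, hA, smul_zero]

/-- The site `c` is a spectator: every generator that can connect `x` to `y` acts as the identity
there. Generators on other links contribute zero before and after the update. -/
theorem quasiLocal_apply_update {B : Op N d} (hB : B ∈ quasiLocal N d) {x y : Config N d}
    {c : ZMod N} (v : Fin d) (hc : x c = y c)
    (h : ∀ i, AgreeOff i x y → c ≠ i ∧ c ≠ i + 1) :
    B (Function.update x c v) (Function.update y c v) = B x y := by
  have hiff : ∀ i, AgreeOff i (Function.update x c v) (Function.update y c v) ↔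
      AgreeOff i x y := by
    refine fun i => forall_congr' fun k => ?_
    by_cases hk : k = c
    · subst hk
      simp [hc]
    · simp [hk]
  induction hB using Submodule.span_induction with
  | mem A hA =>
    obtain ⟨i, C, rfl⟩ := Set.mem_iUnion.1 hA
    rw [onLink_apply, onLink_apply]
    simp only [hiff]
    split_ifs with hi
    · simp [linkPart, (h i hi).1.symm, (h i hi).2.symm]
    · rfl
  | zero => rfl
  | add A C _ _ hA hC => rw [Matrix.add_apply, hA, hC, Matrix.add_apply]
  | smul c A _ hA => rw [Matrix.smul_apply, hA, Matrix.smul_apply]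

/-- An eigenvector of all quasi-local operators annihilating `ψ` is one of the kernelizer. -/
theorem isCommonEigenstate_of_quasiLocal {ψ φ : ManyBody N d} (hφ : φ ≠ 0)
    (h : ∀ B ∈ quasiLocal N d, toEuclideanLin B ψ = 0 → ∃ c : ℂ, toEuclideanLin B φ = c • φ) :
    IsCommonEigenstate ψ φ := by
  intro A hA
  obtain ⟨B, ⟨hBq, -, hBψ⟩, T, hT, rfl⟩ := Submodule.mem_sup.1 hA
  obtain ⟨t, rfl⟩ := Submodule.mem_span_singleton.1 hT
  obtain ⟨c, hc⟩ := h B hBq hBψ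
  have ht : t • (1 : Op N d) = (t : ℂ) • (1 : Op N d) := by
    ext x y
    simp
  refine ⟨c + t, Module.End.mem_eigenspace_iff.2 ?_, hφ⟩
  rw [ht, map_add, map_smul, toLpLin_one, LinearMap.add_apply, hc, add_smul]
  rfl

theorem toEuclideanLin_single_apply (B : Op N d) (x y : Config N d) :
    toEuclideanLin B (EuclideanSpace.single y 1) x = B x y := by
  simp [mulVec, dotProduct, Pi.single_apply]

end Locality

/-! ### The GHZ state -/

section GHZ

variable {N : ℕ}

theorem zero_ne_one_config : (fun _ => 0 : Config N 2) ≠ fun _ => 1 :=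
  fun h => by simpa using congrFun h 0

theorem inv_sqrt_two_ne_zero : ((1 / √2 : ℝ) : ℂ) ≠ 0 := by
  simp

variable [NeZero N]

theorem ghz_apply (x : Config N 2) : ghz N x =
    ((1 / √2 : ℝ) : ℂ) * ((if x = fun _ => 0 then 1 else 0) + if x = fun _ => 1 then 1 else 0) := by
  simp [ghz, mul_add]

theorem ghzMinus_apply (x : Config N 2) : ghzMinus N x =
    ((1 / √2 : ℝ) : ℂ) * ((if x = fun _ => 0 then 1 else 0) - if x = fun _ => 1 then 1 else 0) := by
  simp [ghzMinus]

theorem norm_ghz : ‖ghz N‖ = 1 := by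
  have h : ‖ghz N‖ ^ 2 = 1 := by
    rw [EuclideanSpace.norm_sq_eq]
    have : ∀ x, ‖ghz N x‖ ^ 2 =
        (if x = fun _ => 0 then (1 / 2 : ℝ) else 0) + if x = fun _ => 1 then (1 / 2 : ℝ) else 0 := by
      intro x
      rw [ghz_apply]
      by_cases h0 : x = fun _ => 0
      · subst h0
        simp [zero_ne_one_config]
      · by_cases h1 : x = fun _ => 1
        · subst h1
          simp [zero_ne_one_config.symm]
        · simp [h0, h1]
    simp only [this, Finset.sum_add_distrib, Finset.sum_ite_eq', Finset.mem_univ, if_true]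
    norm_num
  exact (pow_eq_one_iff_of_nonneg (norm_nonneg _) two_ne_zero).1 h

theorem ghzMinus_notMem_span : ghzMinus N ∉ Submodule.span ℂ {ghz N} := by
  intro h
  obtain ⟨c, hc⟩ := Submodule.mem_span_singleton.1 h
  have h0 := congrArg (fun v : ManyBody N 2 => v fun _ => 0) hc
  have h1 := congrArg (fun v : ManyBody N 2 => v fun _ => 1) hc
  simp only [PiLp.smul_apply, ghz_apply, ghzMinus_apply, if_true, if_neg zero_ne_one_config,
    if_neg zero_ne_one_config.symm, smul_eq_mul, add_zero, sub_zero, zero_add, zero_sub, mul_one,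
    mul_neg] at h0 h1
  have : (2 : ℂ) * ((1 / √2 : ℝ) : ℂ) = 0 := by linear_combination h1 - h0
  simp at this

theorem ghzMinus_ne_zero : ghzMinus N ≠ 0 :=
  fun h => ghzMinus_notMem_span (h ▸ Submodule.zero_mem _)

theorem reduced_ghzMinus (hN : 3 ≤ N) (i : ZMod N) :
    reduced i (pureState (ghzMinus N)) = reduced i (pureState (ghz N)) := by
  -- The site `i + 2` is off the link once `N ≥ 3`, so the partial trace removes the cross terms,
  -- the only ones sensitive to the relative sign.
  have h01 : ¬ AgreeOff i (fun _ => 0 : Config N 2) fun _ => 1 := by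
    intro h
    have h1 := natCast_ne_zero_of_lt (n := 1) one_pos (show 1 < N by omega)
    have h2 := natCast_ne_zero_of_lt (n := 2) two_pos (show 2 < N by omega)
    push_cast at h1 h2
    refine absurd (h (i + 2) (fun e => h2 ?_) fun e => h1 ?_) (by simp)
    · linear_combination e
    · linear_combination e
  ext p q
  refine Finset.sum_congr rfl fun x _ => Finset.sum_congr rfl fun y _ => ?_
  refine ite_congr rfl (fun h => ?_) fun _ => rfl
  simp only [pureState, of_apply, ghz_apply, ghzMinus_apply]
  by_cases hx0 : x = fun _ => 0
  · by_cases hy1 : y = fun _ => 1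
    · subst hx0 hy1
      exact absurd h.2.2 h01
    · subst hx0
      simp [hy1, zero_ne_one_config]
  · by_cases hx1 : x = fun _ => 1
    · by_cases hy0 : y = fun _ => 0
      · subst hx1 hy0
        exact absurd h.2.2.symm h01
      · subst hx1
        by_cases hy1 : y = fun _ => 1
        · subst hy1
          simp [zero_ne_one_config.symm]
        · simp [hy0, hy1]
    · simp [hx0, hx1]

theorem ghzMinus_mem_cold (hN : 3 ≤ N) (i : ZMod N) : ghzMinus N ∈ cold (ghz N) i := by
  have h := self_mem_cold (by omega) (ghzMinus N) i
  rwa [cold, coldLocal, reduced_ghzMinus hN] at h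

theorem isCommonEigenstate_ghzMinus (hN : 5 ≤ N) : IsCommonEigenstate (ghz N) (ghzMinus N) := by
  refine isCommonEigenstate_of_quasiLocal ghzMinus_ne_zero fun B hB hψ => ⟨0, ?_⟩
  rw [ghz, map_smul, smul_eq_zero_iff_right inv_sqrt_two_ne_zero, map_add] at hψ
  rw [ghzMinus, map_smul, map_sub, zero_smul, smul_eq_zero_iff_right inv_sqrt_two_ne_zero]
  ext x
  have hx := congrArg (fun v : ManyBody N 2 => v x) hψ
  simp only [PiLp.add_apply, PiLp.sub_apply, PiLp.zero_apply, toEuclideanLin_single_apply]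
    at hx ⊢
  suffices h : B x (fun _ => 0) = 0 by
    rw [h, zero_add] at hx
    rw [h, hx, sub_zero]
  by_contra h0
  have h1 : B x (fun _ => 1) ≠ 0 := fun h => h0 (by rw [h, add_zero] at hx; exact hx)
  obtain ⟨i, hi⟩ := exists_agreeOff_of_ne_zero hB h0
  obtain ⟨j, hj⟩ := exists_agreeOff_of_ne_zero hB h1
  -- At a site outside both links `x` would be 0 and 1 at once.
  have hsub : (Finset.univ : Finset (ZMod N)) ⊆ {i, i + 1, j, j + 1} := by
    intro k _
    by_contra hk
    simp only [Finset.mem_insert, Finset.mem_singleton, not_or] at hk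
    have e0 := hi k hk.1 hk.2.1
    have e1 := hj k hk.2.2.1 hk.2.2.2
    rw [e0] at e1
    simp at e1
  have hcard := (Finset.card_le_card hsub).trans Finset.card_le_four
  rw [Finset.card_univ, ZMod.card] at hcard
  omega

end GHZ

/-! ### The W state -/

section W

variable {N : ℕ}

theorem single_inj {k l : ZMod N} :
    (Pi.single k 1 : Config N 2) = Pi.single l 1 ↔ k = l := by
  refine ⟨fun h => ?_, fun h => h ▸ rfl⟩
  by_contra hkl
  simpa [hkl] using congrFun h k

variable [NeZero N]

theorem wState_apply (x : Config N 2) : wState N x =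
    ((1 / √(N : ℝ) : ℝ) : ℂ) * ∑ k : ZMod N, if x = Pi.single k 1 then 1 else 0 := by
  simp [wState, Pi.single_apply]

theorem inv_sqrt_natCast_ne_zero : ((1 / √(N : ℝ) : ℝ) : ℂ) ≠ 0 := by
  simp [NeZero.ne N]

theorem wState_single (k : ZMod N) : wState N (Pi.single k 1) = ((1 / √(N : ℝ) : ℝ) : ℂ) := by
  rw [wState_apply]
  simp [single_inj]

theorem wState_zero : wState N (fun _ => 0) = 0 := by
  rw [wState_apply, Finset.sum_eq_zero, mul_zero]
  intro k _
  refine if_neg fun h => ?_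
  simpa using congrFun h k

theorem norm_wState : ‖wState N‖ = 1 := by
  have horth : Orthonormal ℂ fun k : ZMod N =>
      (EuclideanSpace.single (Pi.single k 1 : Config N 2) (1 : ℂ)) := by
    simpa [Function.comp_def] using (EuclideanSpace.basisFun (Config N 2) ℂ).orthonormal.comp
      (fun k : ZMod N => Pi.single k 1) fun _ _ => single_inj.1
  have h : ‖∑ k : ZMod N, EuclideanSpace.single (Pi.single k 1 : Config N 2) (1 : ℂ)‖ ^ 2
      = N := by
    have := horth.inner_sum (fun _ => 1) (fun _ => 1) Finset.univ
    simp only [one_smul, map_one, mul_one, Finset.sum_const, Finset.card_univ, ZMod.card,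
      inner_self_eq_norm_sq_to_K] at this
    have h' := congrArg Complex.re this
    simpa [← Complex.ofReal_pow] using h'
  rw [wState, norm_smul, Complex.norm_real, ← Real.sqrt_sq (norm_nonneg (∑ _, _)), h]
  have : √(N : ℝ) ≠ 0 := by simp [NeZero.ne N]
  rw [Real.norm_of_nonneg (by positivity)]
  field_simp

theorem wZero_apply (x : Config N 2) : wZero N x = if x = fun _ => 0 then 1 else 0 := by
  simp [wZero]

theorem wZero_ne_zero : wZero N ≠ 0 := fun h => by
  simpa [wZero_apply] using congrArg (fun v : ManyBody N 2 => v fun _ => 0) h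

theorem wZero_notMem_span : wZero N ∉ Submodule.span ℂ {wState N} := by
  intro h
  obtain ⟨c, hc⟩ := Submodule.mem_span_singleton.1 h
  have h0 := congrArg (fun v : ManyBody N 2 => v fun _ => 0) hc
  simp [wState_zero, wZero_apply] at h0

theorem wZero_mem_cold (hN : 3 ≤ N) (i : ZMod N) : wZero N ∈ cold (wState N) i := by
  have h1 := natCast_ne_zero_of_lt (n := 1) one_pos (show 1 < N by omega)
  have h2 := natCast_ne_zero_of_lt (n := 2) two_pos (show 2 < N by omega)
  push_cast at h1 h2
  have hi : i + 2 ≠ i := fun e => h2 (by linear_combination e)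
  have hi' : i + 2 ≠ i + 1 := fun e => h1 (by linear_combination e)
  have hN' : 2 ≤ N := by omega
  refine mem_tensorRest.2 fun y => ?_
  by_cases hy : AgreeOff i y fun _ => 0
  · have hmem := mem_tensorRest.1 (self_mem_cold hN' (wState N) i) (Pi.single (i + 2) 1)
    -- One excitation at `i + 2` leaves the link in `|00⟩`: this slice of W is the slice of the
    -- vacuum up to normalisation.
    have key : slice i y (wZero N) = (((1 / √(N : ℝ) : ℝ) : ℂ))⁻¹ •
        slice i (Pi.single (i + 2) 1) (wState N) := by
      ext p
      rw [slice_apply, PiLp.smul_apply, slice_apply, smul_eq_mul]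
      by_cases hp : p = (0, 0)
      · subst hp
        have e1 : setLink i y (0, 0) = fun _ => 0 := setLink_eq_of_agreeOff hN' hy
        have e2 : setLink i (Pi.single (i + 2) 1 : Config N 2) (0, 0) = Pi.single (i + 2) 1 := by
          have := setLink_linkPart hN' i (Pi.single (i + 2) 1 : Config N 2)
          rwa [linkPart, Pi.single_eq_of_ne hi.symm, Pi.single_eq_of_ne hi'.symm] at this
        rw [e1, e2, wZero_apply, if_pos rfl, wState_single,
          inv_mul_cancel₀ inv_sqrt_natCast_ne_zero]
      · have e1 : setLink i y p ≠ fun _ => 0 := fun h => hp <| by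
          rw [← linkPart_setLink hN' i y p, h]
          rfl
        rw [wZero_apply, if_neg e1, wState_apply, Finset.sum_eq_zero, mul_zero, mul_zero]
        intro k _
        refine if_neg fun h => hp ?_
        have hk : i + 2 = k := by
          by_contra hk
          have := congrFun h (i + 2)
          rw [setLink_apply_of_ne i _ p hi hi', Pi.single_eq_same, Pi.single_eq_of_ne hk] at this
          simp at this
        rw [← linkPart_setLink hN' i (Pi.single (i + 2) 1) p, h, ← hk, linkPart,
          Pi.single_eq_of_ne hi.symm, Pi.single_eq_of_ne hi'.symm]
    rw [key]
    exact Submodule.smul_mem _ _ hmem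
  · have : slice i y (wZero N) = 0 := by
      ext p
      rw [slice_apply, wZero_apply]
      exact if_neg fun h => hy fun k hk hk' => by
        rw [← setLink_apply_of_ne i y p hk hk', h]
    rw [this]
    exact Submodule.zero_mem _

variable {B : Op N 2}

theorem sum_apply_single_eq_zero (hψ : toEuclideanLin B (wState N) = 0) (z : Config N 2) :
    ∑ k : ZMod N, B z (Pi.single k 1) = 0 := by
  rw [wState, map_smul, smul_eq_zero_iff_right inv_sqrt_natCast_ne_zero, map_sum] at hψ
  have h := congrArg (fun v : ManyBody N 2 => v z) hψ
  simpa [toEuclideanLin_single_apply] using h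

theorem apply_update_single (hB : B ∈ quasiLocal N 2) {x : Config N 2} {c : ZMod N}
    (hc : x c = 0) (h : ∀ i, AgreeOff i x (fun _ => 0) → c ≠ i ∧ c ≠ i + 1) :
    B (Function.update x c 1) (Pi.single c 1) = B x fun _ => 0 :=
  quasiLocal_apply_update hB (y := fun _ => 0) 1 hc h

/-- Quasi-local annihilators of the W state create no pairs of neighbouring excitations. -/
theorem apply_pair_zero (hN : 5 ≤ N) (hB : B ∈ quasiLocal N 2)
    (hψ : toEuclideanLin B (wState N) = 0) (a : ZMod N) :
    B (Function.update (Pi.single a 1) (a + 1) 1) (fun _ => 0) = 0 := by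
  have h1 := natCast_ne_zero_of_lt (n := 1) (by omega) (show 1 < N by omega)
  have h2 := natCast_ne_zero_of_lt (n := 2) (by omega) (show 2 < N by omega)
  have h3 := natCast_ne_zero_of_lt (n := 3) (by omega) (show 3 < N by omega)
  have h4 := natCast_ne_zero_of_lt (n := 4) (by omega) (show 4 < N by omega)
  push_cast at h1 h2 h3 h4
  -- The spectator site must differ from `a` and `a + 1` and neighbour neither; around the ring this
  -- needs `4 ≠ 0`, hence `N ≥ 5`.
  obtain ⟨c, hc⟩ : ∃ c, c = a + 3 := ⟨_, rfl⟩
  obtain ⟨b, hb⟩ : ∃ b, b = a + 1 := ⟨_, rfl⟩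
  have hba : b ≠ a := fun e => h1 (by linear_combination e - hb)
  have hca : c ≠ a := fun e => h3 (by linear_combination e - hc)
  have hcb : c ≠ b := fun e => h2 (by linear_combination e - hc + hb)
  have hca1 : c ≠ a + 1 := hb ▸ hcb
  have hac1 : a ≠ c + 1 := fun e => h4 (by linear_combination -e - hc)
  have hcb1 : c ≠ b + 1 := fun e => h1 (by linear_combination e - hc + hb)
  have hbc1 : b ≠ c + 1 := fun e => h3 (by linear_combination -e - hc + hb)
  rw [← hb]
  obtain ⟨x, hx⟩ : ∃ x : Config N 2, x = Function.update (Pi.single a 1) b 1 := ⟨_, rfl⟩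
  have hxa : x a = 1 := by simp [hx, hba.symm]
  have hxb : x b = 1 := by simp [hx]
  have hxc : x c = 0 := by simp [hx, hca, hcb]
  rw [← hx, ← apply_update_single hB hxc fun i hi => ?_]
  · have hsum := sum_apply_single_eq_zero hψ (Function.update x c 1)
    rwa [Finset.sum_eq_single c ?_ (by simp)] at hsum
    -- If `k ≠ c`, the two configurations differ at `c` and at whichever of `a`, `b` is not `k`, and
    -- no link contains both sites.
    intro k _ hk
    by_contra h0
    obtain ⟨i, hi⟩ := exists_agreeOff_of_ne_zero hB h0
    have hdc : (Function.update x c 1 : Config N 2) c ≠ (Pi.single k 1 : Config N 2) c := by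
      simp [hk.symm]
    by_cases hka : k = a
    · refine not_agreeOff_of_ne (a := b) (c := c) ?_ hdc hcb hcb1 hbc1 hi
      simp [hcb.symm, hxb, hka, hba]
    · refine not_agreeOff_of_ne (a := a) (c := c) ?_ hdc hca hca1 hac1 hi
      simp [hca.symm, hxa, Ne.symm hka]
  · have ha := eq_or_eq_of_agreeOff hi (k := a) (by simp [hxa])
    refine ⟨fun e => ?_, fun e => ?_⟩
    · rcases ha with ha | ha
      · exact hca (e.trans ha.symm)
      · exact hac1 (by rw [e, ha])
    · rcases ha with ha | ha
      · exact hca1 (by rw [e, ha])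
      · exact hca (e.trans ha.symm)

/-- For a quasi-local annihilator of the W state, the amplitudes of creating an excitation on two
sites that are not neighbours are opposite to each other. -/
theorem apply_single_add_apply_single (hB : B ∈ quasiLocal N 2)
    (hψ : toEuclideanLin B (wState N) = 0) {a c : ZMod N} (h : c ≠ a) (h1 : c ≠ a + 1)
    (h2 : a ≠ c + 1) :
    B (Pi.single a 1) (fun _ => 0) + B (Pi.single c 1) (fun _ => 0) = 0 := by
  have key : ∀ a c : ZMod N, c ≠ a → c ≠ a + 1 → a ≠ c + 1 →
      B (Function.update (Pi.single a 1) c 1) (Pi.single c 1) =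
        B (Pi.single a 1) (fun _ => 0) := by
    intro a c h h1 h2
    refine apply_update_single hB (Pi.single_eq_of_ne h _) fun i hi => ?_
    rcases eq_or_eq_of_agreeOff hi (k := a) (by simp) with rfl | rfl
    · exact ⟨h, h1⟩
    · exact ⟨fun e => h2 (by rw [e]), h⟩
  have hcomm : (Function.update (Pi.single a 1) c 1 : Config N 2) =
      Function.update (Pi.single c 1) a 1 := Function.update_comm h.symm _ _ _
  have hsum := sum_apply_single_eq_zero hψ (Function.update (Pi.single a 1) c 1)
  rw [Finset.sum_eq_add a c h.symm ?_ (by simp) (by simp), key a c h h1 h2, hcomm,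
    key c a h.symm h2 h1, add_comm] at hsum
  · exact hsum
  -- For any third `k` the configurations differ at `a`, `c` and `k`, too many sites for one link.
  · rintro k - ⟨hka, hkc⟩
    by_contra h0
    obtain ⟨i, hi⟩ := exists_agreeOff_of_ne_zero hB h0
    refine not_agreeOff_of_ne₃ (a := a) (b := c) (c := k) ?_ ?_ ?_ h.symm hka.symm hkc.symm hi
    · simp [h.symm, hka.symm]
    · simp [hkc.symm]
    · simp [hka, hkc]

/-- Quasi-local annihilators of the W state create no single excitations. -/
theorem apply_single_zero (hN : 5 ≤ N) (hB : B ∈ quasiLocal N 2)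
    (hψ : toEuclideanLin B (wState N) = 0) (a : ZMod N) :
    B (Pi.single a 1) (fun _ => 0) = 0 := by
  have h1 := natCast_ne_zero_of_lt (n := 1) (by omega) (show 1 < N by omega)
  have h2 := natCast_ne_zero_of_lt (n := 2) (by omega) (show 2 < N by omega)
  have h3 := natCast_ne_zero_of_lt (n := 3) (by omega) (show 3 < N by omega)
  have h4 := natCast_ne_zero_of_lt (n := 4) (by omega) (show 4 < N by omega)
  push_cast at h1 h2 h3 h4
  have step : ∀ a : ZMod N, B (Pi.single a 1) (fun _ => 0) +
      B (Pi.single (a + 2) 1) (fun _ => 0) = 0 := fun a =>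
    apply_single_add_apply_single hB hψ (fun e => h2 (by linear_combination e))
      (fun e => h1 (by linear_combination e)) (fun e => h3 (by linear_combination -e))
  have s1 := step a
  have s2 := step (a + 2)
  -- Signs alternate along steps of two, so an odd cycle forces zero. For `N = 5` the steps close up
  -- after five; otherwise `a`, `a + 2`, `a + 4` are pairwise non-neighbours and form a triangle.
  by_cases h5 : (5 : ZMod N) = 0
  · have s3 := step (a + 2 + 2)
    have s4 := step (a + 2 + 2 + 2)
    have s5 := step (a + 2 + 2 + 2 + 2)
    have e : a + 2 + 2 + 2 + 2 + 2 = a := by linear_combination 2 * h5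
    rw [e] at s5
    linear_combination (s1 - s2 + s3 - s4 + s5) / 2
  · have s3 := apply_single_add_apply_single hB hψ (a := a) (c := a + 2 + 2)
      (fun e => h4 (by linear_combination e)) (fun e => h3 (by linear_combination e))
      (fun e => h5 (by linear_combination -e))
    linear_combination (s1 - s2 + s3) / 2

theorem isCommonEigenstate_wZero (hN : 5 ≤ N) : IsCommonEigenstate (wState N) (wZero N) := by
  refine isCommonEigenstate_of_quasiLocal wZero_ne_zero fun B hB hψ =>
    ⟨B (fun _ => 0) (fun _ => 0), ?_⟩
  ext x
  rw [PiLp.smul_apply, wZero_apply, wZero, toEuclideanLin_single_apply]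
  by_cases hx : x = fun _ => 0
  · simp [hx]
  rw [if_neg hx, smul_zero]
  by_contra h0
  obtain ⟨i, hi⟩ := exists_agreeOff_of_ne_zero hB h0
  have hii : i + 1 ≠ i := add_one_ne_self (by omega) i
  -- All excitations of `x` sit on the link, leaving four cases: the excluded vacuum, two single
  -- excitations, and the pair.
  have hx' : x = Function.update (Pi.single i (x i)) (i + 1) (x (i + 1)) := by
    funext k
    by_cases hk : k = i
    · subst hk
      simp [hii.symm]
    by_cases hk' : k = i + 1
    · subst hk'
      simp
    · simp [hk, hk', hi k hk hk']
  have h01 : ∀ v : Fin 2, v = 0 ∨ v = 1 := by decide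
  rcases h01 (x i) with e | e <;> rcases h01 (x (i + 1)) with e' | e' <;> rw [e, e'] at hx'
  · refine hx (hx'.trans ?_)
    simp only [Pi.single_zero]
    exact Function.update_eq_self (i + 1) (0 : Config N 2)
  · rw [hx', Pi.single_zero] at h0
    exact h0 (apply_single_zero hN hB hψ (i + 1))
  · have e2 : Function.update (Pi.single i 1 : Config N 2) (i + 1) 0 = Pi.single i 1 := by
      rw [Function.update_eq_self_iff, Pi.single_eq_of_ne hii]
    rw [hx', e2] at h0
    exact h0 (apply_single_zero hN hB hψ i)
  · rw [hx'] at h0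
    exact h0 (apply_pair_zero hN hB hψ i)

end W

end DiluteCooling

theorem mainTheorem4 :
    -- the necessary condition, for every chain, every target and every set of cooled links
    (∀ (N d : ℕ) [NeZero N], 2 ≤ N → ∀ (ψ : ManyBody N d), ‖ψ‖ = 1 → ∀ S : Finset (ZMod N),
      Coolable ψ S →
        ¬ ∃ φ : ManyBody N d, φ ∉ Submodule.span ℂ {ψ} ∧ (∀ i ∈ S, φ ∉ hot ψ i) ∧
          IsCommonEigenstate ψ φ) ∧
    -- the GHZ state and its partner
    (∀ (N : ℕ) [NeZero N], 5 ≤ N →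
      (∀ i : ZMod N, reduced i (pureState (ghzMinus N)) = reduced i (pureState (ghz N))) ∧
      IsCommonEigenstate (ghz N) (ghzMinus N) ∧
      (∀ i : ZMod N, ghzMinus N ∈ cold (ghz N) i ∧
        ghzMinus N ∉ Submodule.span ℂ {ghz N} ⊔ hot (ghz N) i) ∧
      ∀ S : Finset (ZMod N), ¬ Coolable (ghz N) S) ∧
    -- the W state and its partner
    (∀ (N : ℕ) [NeZero N], 5 ≤ N →
      IsCommonEigenstate (wState N) (wZero N) ∧
      (∀ i : ZMod N, wZero N ∈ cold (wState N) i ∧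
        wZero N ∉ Submodule.span ℂ {wState N} ⊔ hot (wState N) i) ∧
      ∀ S : Finset (ZMod N), ¬ Coolable (wState N) S) := by
  refine ⟨?_, ?_, ?_⟩
  · rintro N d _ hN ψ hψ S hS ⟨φ, hφ, hhot, hK⟩
    exact not_coolable_of_isCommonEigenstate hN hψ hφ hhot hK hS
  · intro N _ hN
    have hspan : ∀ i : ZMod N, ghzMinus N ∉ Submodule.span ℂ {ghz N} ⊔ hot (ghz N) i := fun i =>
      notMem_span_sup_hot (by omega) (ghzMinus_mem_cold (by omega) i) ghzMinus_notMem_span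
    exact ⟨reduced_ghzMinus (by omega), isCommonEigenstate_ghzMinus hN,
      fun i => ⟨ghzMinus_mem_cold (by omega) i, hspan i⟩, fun S =>
        not_coolable_of_isCommonEigenstate (by omega) norm_ghz ghzMinus_notMem_span
          (fun i _ h => hspan i (Submodule.mem_sup_right h)) (isCommonEigenstate_ghzMinus hN)⟩
  · intro N _ hN
    have hspan : ∀ i : ZMod N, wZero N ∉ Submodule.span ℂ {wState N} ⊔ hot (wState N) i :=
      fun i => notMem_span_sup_hot (by omega) (wZero_mem_cold (by omega) i) wZero_notMem_span
    exact ⟨isCommonEigenstate_wZero hN,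
      fun i => ⟨wZero_mem_cold (by omega) i, hspan i⟩, fun S =>
        not_coolable_of_isCommonEigenstate (by omega) norm_wState wZero_notMem_span
          (fun i _ h => hspan i (Submodule.mem_sup_right h)) (isCommonEigenstate_wZero hN)⟩
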